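/- Let $G$ be a locally compact, second countable Hausdorff group. All locally compact spaces are assumed Hausdorff. A continuous action of $G$ on a locally compact space $\Omega$ is called proper if for all compact $K,L\subset\Omega$ the set $\{g\in G: gK\cap L\neq\emptyset\}$ is relatively compact in $G$. For a regular Borel measure $\mu$ on $\Omega$ (finite on compact sets, outer regular on Borel sets, inner regular on open sets), $L^\infty(\Omega)=L^\infty(\Omega,\mu)$ denotes the space of locally measurable, locally essentially bounded real functions (that is, functions that are $\mu$-measurable on every compact set and satisfy, for one constant $C$, $|f|\le C$ almost everywhere on every compact set), modulo equality almost everywhere on every compact set; this is the usual $L^\infty$ when $\mu$ is $\sigma$-finite. If $\mu$ is $G$-invariant, a $G$-invariant mean on $L^\infty(\Omega)$ is a positive linear functional $m$ with $m(1)=1$ and $m(g\cdot f)=m(f)$ for all $g\in G$ and $f\in L^\infty(\Omega)$, where $(g\cdot f)(x)=f(g^{-1}x)$. The group $G$ is amenable if $L^\infty(G)$ (for a left Haar measure) has a mean invariant under left translation. (1) Let $\Omega$ be a locally compact space on which $G$ acts continuously and properly, equipped with a $G$-invariant regular Borel measure $\mu$. If $L^\infty(\Omega,\mu)$ has a $G$-invariant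 mean, then $G$ is amenable. (2) Consequently, $G$ is amenable if and only if there exist a locally compact space $\Omega$, a continuous proper action of $G$ on $\Omega$ and a $G$-invariant regular Borel measure $\mu$ on $\Omega$ such that $L^\infty(\Omega,\mu)$ has a $G$-invariant mean. -/

import Mathlib

open MeasureTheory

universe u v

/-- A property holds locally almost everywhere if, on every compact set, it holds outside a
null set. For a `σ`-compact space (in particular a second countable locally compact one) or a
`σ`-finite regular measure this is the same as holding almost everywhere. -/
def LocallyAE {Ω : Type v} [TopologicalSpace Ω] [MeasurableSpace Ω] (μ : Measure Ω)
    (p : Ω → Prop) : Prop :=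
  ∀ K : Set Ω, IsCompact K → ∀ᵐ x ∂(μ.restrict K), p x

/-- The space of real functions on `Ω` that are measurable on every compact set (up to null sets)
and locally essentially bounded, with one bound for the whole of `Ω`. -/
def EssBounded {Ω : Type v} [TopologicalSpace Ω] [MeasurableSpace Ω] (μ : Measure Ω) :
    Submodule ℝ (Ω → ℝ) where
  carrier := {f | (∀ K : Set Ω, IsCompact K → AEMeasurable f (μ.restrict K)) ∧
    ∃ C : ℝ, LocallyAE μ (fun x => |f x| ≤ C)}
  zero_mem' := ⟨fun _ _ => aemeasurable_const,
    0, fun _ _ => Filter.Eventually.of_forall fun _ => by simp⟩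
  add_mem' := by
    rintro f h ⟨hf, C, hC⟩ ⟨hh, D, hD⟩
    refine ⟨fun K hK => (hf K hK).add (hh K hK), C + D, fun K hK => ?_⟩
    filter_upwards [hC K hK, hD K hK] with x h1 h2
    exact (abs_add_le _ _).trans (add_le_add h1 h2)
  smul_mem' := by
    rintro c f ⟨hf, C, hC⟩
    refine ⟨fun K hK => (hf K hK).const_smul c, |c| * C, fun K hK => ?_⟩
    filter_upwards [hC K hK] with x h1
    simpa [abs_mul] using mul_le_mul_of_nonneg_left h1 (abs_nonneg c)

/-- The functions of `EssBounded μ` that vanish locally almost everywhere. -/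
def EssNull {Ω : Type v} [TopologicalSpace Ω] [MeasurableSpace Ω] (μ : Measure Ω) :
    Submodule ℝ (EssBounded μ) where
  carrier := {f | LocallyAE μ (fun x => f.1 x = 0)}
  zero_mem' := fun _ _ => Filter.Eventually.of_forall fun _ => rfl
  add_mem' := by
    intro f h hf hh K hK
    filter_upwards [hf K hK, hh K hK] with x h1 h2
    simp [h1, h2]
  smul_mem' := by
    intro c f hf K hK
    filter_upwards [hf K hK] with x h1
    simp [h1]

/-- The (real) space `L^∞(Ω, μ)` of a measure on a locally compact space: essentially bounded
locally measurable functions modulo equality locally almost everywhere. This is the usual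
definition for Radon measures that need not be `σ`-finite (it makes `L^∞` the dual of `L^1`), and
it is the usual `L^∞` when `Ω` is `σ`-compact or the regular measure `μ` is `σ`-finite. -/
abbrev LInfty {Ω : Type v} [TopologicalSpace Ω] [MeasurableSpace Ω] (μ : Measure Ω) : Type v :=
  EssBounded μ ⧸ EssNull μ

/-- The class of an essentially bounded function in `L^∞`. -/
abbrev LInfty.mk {Ω : Type v} [TopologicalSpace Ω] [MeasurableSpace Ω] {μ : Measure Ω}
    (f : EssBounded μ) : LInfty μ :=
  (EssNull μ).mkQ f

/-- The constant function `1`. -/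
def EssBounded.one {Ω : Type v} [TopologicalSpace Ω] [MeasurableSpace Ω] (μ : Measure Ω) :
    EssBounded μ :=
  ⟨fun _ => 1, fun _ _ => aemeasurable_const,
    1, fun _ _ => Filter.Eventually.of_forall fun _ => by simp⟩

section Translate

variable {G : Type u} {Ω : Type v} [Group G] [TopologicalSpace Ω] [MeasurableSpace Ω]
  [BorelSpace Ω] [MulAction G Ω] [ContinuousConstSMul G Ω] (μ : Measure Ω)
  [SMulInvariantMeasure G Ω μ]

theorem quasiMeasurePreserving_smul_restrict (g : G) (K : Set Ω) :
    Measure.QuasiMeasurePreserving (fun x : Ω => g⁻¹ • x) (μ.restrict K)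
      (μ.restrict ((fun x : Ω => g⁻¹ • x) '' K)) := by
  have h : MeasurePreserving (fun x : Ω => g⁻¹ • x) μ μ := measurePreserving_smul g⁻¹ μ
  have h2 := h.restrict_image_emb (Homeomorph.smul g⁻¹ : Ω ≃ₜ Ω).measurableEmbedding K
  exact h2.quasiMeasurePreserving

/-- The translate `(g · f)(x) = f (g⁻¹ x)`. -/
def EssBounded.translate (g : G) (f : EssBounded μ) : EssBounded μ :=
  ⟨fun x => f.1 (g⁻¹ • x), by
    obtain ⟨f, hf, C, hC⟩ := f
    have hK : ∀ K : Set Ω, IsCompact K → IsCompact ((fun x : Ω => g⁻¹ • x) '' K) :=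
      fun K hK => hK.image (continuous_const_smul g⁻¹)
    exact ⟨fun K h => (hf _ (hK K h)).comp_quasiMeasurePreserving
        (quasiMeasurePreserving_smul_restrict μ g K),
      C, fun K h => (quasiMeasurePreserving_smul_restrict μ g K).ae (hC _ (hK K h))⟩⟩

end Translate

/-- `L^∞(Ω, μ)` has a `G`-invariant mean: a linear functional `m` that is positive, satisfies
`m 1 = 1`, and is invariant under `(g · f)(x) = f (g⁻¹ x)`. -/
def HasInvariantMean (G : Type u) {Ω : Type v} [Group G] [TopologicalSpace Ω]
    [MeasurableSpace Ω] [BorelSpace Ω] [MulAction G Ω] [ContinuousConstSMul G Ω]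
    (μ : Measure Ω) [SMulInvariantMeasure G Ω μ] : Prop :=
  ∃ m : LInfty μ →ₗ[ℝ] ℝ,
    (∀ f : EssBounded μ, LocallyAE μ (fun x => 0 ≤ f.1 x) → 0 ≤ m (LInfty.mk f)) ∧
    m (LInfty.mk (EssBounded.one μ)) = 1 ∧
    ∀ (g : G) (f : EssBounded μ),
      m (LInfty.mk (EssBounded.translate μ g f)) = m (LInfty.mk f)

/-- A locally compact group is amenable if `L^∞(G)`, for a Haar measure, has a mean that is
invariant under the action of `G` on itself by left translation. -/
def IsAmenable (G : Type u) [Group G] [TopologicalSpace G] [IsTopologicalGroup G]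
    [LocallyCompactSpace G] [MeasurableSpace G] [BorelSpace G] : Prop :=
  HasInvariantMean G (Measure.haar : Measure G)

/-- For all compact `K, L ⊆ Ω` the set `{g | g K ∩ L ≠ ∅}` is relatively compact in `G`. -/
def IsProperAction (G : Type u) (Ω : Type v) [Group G] [TopologicalSpace G]
    [TopologicalSpace Ω] [MulAction G Ω] : Prop :=
  ∀ K L : Set Ω, IsCompact K → IsCompact L →
    IsCompact (closure {g : G | (((fun x : Ω => g • x) '' K) ∩ L).Nonempty})

/-!
The idea is to transport means: a positive, unital, `G`-equivariant linear map
`Φ : L^∞(G) → L^∞(Ω, μ)` turns an invariant mean `m` on `L^∞(Ω, μ)` into the invariant mean `m ∘ Φ`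
on `L^∞(G)`. For a proper action such a map is obtained by averaging over orbits: for `φ ≥ 0`
continuous with compact support, properness makes
`orbitIntegral f φ x = ∫ f(g) φ(g⁻¹ x) dg` finite and continuous in `x`, left invariance of Haar
measure makes it equivariant in `f`, and
`Φ f x = orbitIntegral f φ x / orbitIntegral 1 φ x`
has all the required properties at the points `x` whose orbit meets `{φ ≠ 0}`.

In general no single `φ` works on all of `Ω`, and as nothing like paracompactness of `G \ Ω` is
assumed there need not be a continuous partition of unity on the quotient either. Instead `φ` is
allowed to depend measurably on the orbit (`exists_orbit_weight`). By Zorn's lemma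
(`exists_disjoint_orbitSaturations`) there is a maximal family of compact sets with pairwise disjoint
saturations, each of which has positive measure around each of its points. Since `μ` is finite on
relatively compact open sets, the last property implies that a compact set meets only countably many
of the saturations, so that gluing along them preserves local measurability; by inner regularity,
maximality implies that the complement of their union is locally null.

For the converse in the second part, `G` acts properly on itself by left translation.
-/

open Set Filter Topology Function

/-! ### Saturations of sets under a group action -/

section Saturation

variable {G : Type u} {Ω : Type v} [Group G] [MulAction G Ω]

/-- The union `G • K` of the orbits that meet `K`. -/
def orbitSaturation (G : Type u) {Ω : Type v} [Group G] [MulAction G Ω] (K : Set Ω) : Set Ω :=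
  {x | ∃ g : G, g⁻¹ • x ∈ K}

theorem subset_orbitSaturation (K : Set Ω) : K ⊆ orbitSaturation G K :=
  fun x hx => ⟨1, by simpa using hx⟩

theorem smul_mem_orbitSaturation_iff {K : Set Ω} {g : G} {x : Ω} :
    g • x ∈ orbitSaturation G K ↔ x ∈ orbitSaturation G K := by
  constructor
  · rintro ⟨a, ha⟩
    exact ⟨g⁻¹ * a, by simpa [mul_smul] using ha⟩
  · rintro ⟨a, ha⟩
    exact ⟨g * a, by simpa [mul_smul] using ha⟩

theorem orbitSaturation_mono {K L : Set Ω} (h : K ⊆ L) :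
    orbitSaturation G K ⊆ orbitSaturation G L :=
  fun _ ⟨g, hg⟩ => ⟨g, h hg⟩

theorem disjoint_orbitSaturation_of_disjoint {K L : Set Ω}
    (h : Disjoint K (orbitSaturation G L)) :
    Disjoint (orbitSaturation G K) (orbitSaturation G L) := by
  rw [Set.disjoint_left] at h ⊢
  rintro x ⟨g, hg⟩ hx
  exact h hg (smul_mem_orbitSaturation_iff.2 hx)

theorem measurableSet_orbitSaturation [TopologicalSpace G] [SigmaCompactSpace G]
    [TopologicalSpace Ω] [T2Space Ω] [MeasurableSpace Ω] [BorelSpace Ω] [ContinuousSMul G Ω]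
    {K : Set Ω} (hK : IsCompact K) : MeasurableSet (orbitSaturation G K) := by
  have h : orbitSaturation G K =
      ⋃ n, (fun p : G × Ω => p.1 • p.2) '' (compactCovering G n ×ˢ K) := by
    ext x
    simp only [orbitSaturation, mem_ofPred_eq, mem_iUnion, mem_image, mem_prod, Prod.exists]
    constructor
    · rintro ⟨g, hg⟩
      obtain ⟨n, hn⟩ := exists_mem_compactCovering g
      exact ⟨n, g, g⁻¹ • x, ⟨hn, hg⟩, by simp⟩
    · rintro ⟨n, g, y, ⟨-, hy⟩, rfl⟩
      exact ⟨g, by simpa using hy⟩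
  rw [h]
  exact MeasurableSet.iUnion fun n =>
    (((isCompact_compactCovering G n).prod hK).image continuous_smul).measurableSet

end Saturation

/-! ### Exhausting the space by saturations of compact sets -/

section Exhaustion

variable {G : Type u} {Ω : Type v} [Group G] [MulAction G Ω] [TopologicalSpace Ω]
  [MeasurableSpace Ω]

/-- By invariance of the measure, a set that has positive measure around each of its points passes
this property on to its saturation. -/
theorem measure_inter_orbitSaturation_pos [ContinuousConstSMul G Ω] {μ : Measure Ω}
    [BorelSpace Ω] [SMulInvariantMeasure G Ω μ] {K U : Set Ω} (hK : μ.IsEverywherePos K)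
    (hU : IsOpen U) (h : (U ∩ orbitSaturation G K).Nonempty) :
    0 < μ (U ∩ orbitSaturation G K) := by
  obtain ⟨x, hxU, g, hg⟩ := h
  have hV : IsOpen ((fun y : Ω => g • y) ⁻¹' U) := hU.preimage (continuous_const_smul g)
  have hpos : 0 < μ (K ∩ (fun y : Ω => g • y) ⁻¹' U) :=
    hK _ hg _ (inter_mem_nhdsWithin _ (hV.mem_nhds (by simpa using hxU)))
  have hle : K ∩ (fun y : Ω => g • y) ⁻¹' U ⊆
      (fun y : Ω => g • y) ⁻¹' (U ∩ orbitSaturation G K) := fun y hy =>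
    ⟨hy.2, smul_mem_orbitSaturation_iff.2 (subset_orbitSaturation K hy.1)⟩
  calc 0 < μ (K ∩ (fun y : Ω => g • y) ⁻¹' U) := hpos
    _ ≤ μ ((fun y : Ω => g • y) ⁻¹' (U ∩ orbitSaturation G K)) := measure_mono hle
    _ = μ (U ∩ orbitSaturation G K) := measure_preimage_smul μ g _

/-- Up to a locally null set, the space is a locally countable disjoint union of saturations of
compact sets. -/
theorem exists_disjoint_orbitSaturations [TopologicalSpace G] [SigmaCompactSpace G]
    [T2Space Ω] [LocallyCompactSpace Ω] [BorelSpace Ω] [ContinuousSMul G Ω] (μ : Measure Ω)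
    [μ.Regular] [SMulInvariantMeasure G Ω μ] :
    ∃ S : Set (Set Ω), (∀ K ∈ S, IsCompact K) ∧ S.PairwiseDisjoint (orbitSaturation G) ∧
      (∀ L : Set Ω, IsCompact L → {K ∈ S | (L ∩ orbitSaturation G K).Nonempty}.Countable) ∧
      ∀ L : Set Ω, IsCompact L → μ (L \ ⋃ K ∈ S, orbitSaturation G K) = 0 := by
  obtain ⟨S, hS⟩ := zorn_subset
    {S : Set (Set Ω) | (∀ K ∈ S, IsCompact K ∧ μ.IsEverywherePos K) ∧
      S.PairwiseDisjoint (orbitSaturation G)} (by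
    intro c hc hchain
    refine ⟨⋃₀ c, ⟨?_, (pairwiseDisjoint_sUnion hchain.directedOn).2 fun s hs => (hc hs).2⟩,
      fun s hs => subset_sUnion_of_mem hs⟩
    rintro K ⟨s, hs, hK⟩
    exact (hc hs).1 K hK)
  obtain ⟨⟨hSK, hSd⟩, hmax⟩ := hS
  have hcount : ∀ L : Set Ω, IsCompact L →
      {K ∈ S | (L ∩ orbitSaturation G K).Nonempty}.Countable := by
    intro L hL
    obtain ⟨V, hVc, hLV⟩ := exists_compact_superset hL
    have : IsFiniteMeasure (μ.restrict V) := ⟨by simpa using hVc.measure_lt_top⟩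
    have hc : Set.Countable {K : S | 0 < μ.restrict V (orbitSaturation G (K : Set Ω))} :=
      Measure.countable_meas_pos_of_disjoint_iUnion
        (fun K => measurableSet_orbitSaturation (hSK K K.2).1)
        (fun K K' h => hSd K.2 K'.2 (Subtype.coe_injective.ne h))
    refine (hc.image Subtype.val).mono ?_
    rintro K ⟨hKS, hne⟩
    refine ⟨⟨K, hKS⟩, ?_, rfl⟩
    have hm := measurableSet_orbitSaturation (G := G) (hSK K hKS).1
    rw [mem_ofPred_eq, Measure.restrict_apply hm, inter_comm]
    exact (measure_inter_orbitSaturation_pos (hSK K hKS).2 isOpen_interior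
      (hne.mono (inter_subset_inter_left _ hLV))).trans_le
      (measure_mono (inter_subset_inter_left _ interior_subset))
  refine ⟨S, fun K hK => (hSK K hK).1, hSd, hcount, fun L hL => ?_⟩
  have heq : L \ ⋃ K ∈ S, orbitSaturation G K =
      L \ ⋃ K ∈ {K ∈ S | (L ∩ orbitSaturation G K).Nonempty}, orbitSaturation G K := by
    ext x
    simp only [Set.mem_sdiff, mem_iUnion, mem_ofPred_eq, exists_prop, not_exists, not_and]
    refine and_congr_right fun hx => forall_congr' fun K => ?_
    exact ⟨fun h hK => h hK.1, fun h hK hxK => h ⟨hK, x, hx, hxK⟩ hxK⟩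
  have hmeas : MeasurableSet (L \ ⋃ K ∈ S, orbitSaturation G K) := by
    rw [heq]
    exact hL.measurableSet.diff (MeasurableSet.biUnion (hcount L hL) fun K hK =>
      measurableSet_orbitSaturation (hSK K hK.1).1)
  by_contra hne
  -- Otherwise the family could be enlarged by a compact subset of this set.
  obtain ⟨C, hCsub, hC, hCpos⟩ := hmeas.exists_lt_isCompact_of_ne_top
    ((measure_mono sdiff_subset).trans_lt hL.measure_lt_top).ne (pos_iff_ne_zero.2 hne)
  set D := μ.everywherePosSubset C with hD
  have hDC : D ⊆ C := Measure.everywherePosSubset_subset μ C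
  have hDpos : 0 < μ D := by
    rwa [hD, (Measure.everywherePosSubset_ae_eq_of_measure_ne_top hC.measurableSet
      hC.measure_lt_top.ne).measure_eq]
  have hDdisj : ∀ K ∈ S, Disjoint (orbitSaturation G D) (orbitSaturation G K) := by
    intro K hK
    refine disjoint_orbitSaturation_of_disjoint (Set.disjoint_left.2 fun x hx hxK => ?_)
    exact (hCsub (hDC hx)).2 (mem_biUnion hK hxK)
  have hDS : D ∈ S := by
    refine hmax (y := insert D S) ⟨?_, ?_⟩ (subset_insert _ _) (mem_insert _ _)
    · rintro K (rfl | hK)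
      · exact ⟨hC.everywherePosSubset,
          Measure.isEverywherePos_everywherePosSubset_of_measure_ne_top hC.measurableSet
            hC.measure_lt_top.ne⟩
      · exact hSK K hK
    · exact hSd.insert fun K hK _ => hDdisj K hK
  obtain ⟨x, hx⟩ := nonempty_of_measure_ne_zero hDpos.ne'
  exact Set.disjoint_left.1 (hDdisj D hDS) (subset_orbitSaturation D hx)
    (subset_orbitSaturation D hx)

/-- There is a choice `w x` of a nonnegative continuous function with compact support, depending
only on the orbit of `x`, which on every compact set takes countably many values on measurable
pieces, and which for locally almost every `x` does not vanish identically on the orbit of `x`. -/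
theorem exists_orbit_weight [TopologicalSpace G] [SigmaCompactSpace G]
    [T2Space Ω] [LocallyCompactSpace Ω] [BorelSpace Ω] [ContinuousSMul G Ω] (μ : Measure Ω)
    [μ.Regular] [SMulInvariantMeasure G Ω μ] :
    ∃ w : Ω → Ω → ℝ,
      (∀ x, Continuous (w x) ∧ HasCompactSupport (w x) ∧ 0 ≤ w x) ∧
      (∀ (g : G) (x : Ω), w (g • x) = w x) ∧
      (LocallyAE μ fun x => ∃ g : G, w x (g⁻¹ • x) ≠ 0) ∧
      ∀ L : Set Ω, IsCompact L → ∃ T : Set (Set Ω), T.Countable ∧ μ (L \ ⋃₀ T) = 0 ∧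
        ∀ A ∈ T, MeasurableSet A ∧ ∃ φ : Ω → ℝ, Continuous φ ∧ HasCompactSupport φ ∧
          ∀ x ∈ A, w x = φ := by
  classical
  obtain ⟨S, hSK, hSd, hcount, hnull⟩ := exists_disjoint_orbitSaturations (G := G) μ
  have hφ : ∀ K : Set Ω, ∃ φ : Ω → ℝ, (Continuous φ ∧ HasCompactSupport φ ∧ 0 ≤ φ) ∧
      (IsCompact K → ∀ x ∈ K, φ x = 1) := by
    intro K
    by_cases hK : IsCompact K
    · obtain ⟨φ, h1, -, h2, h3⟩ := exists_continuous_one_zero_of_isCompact hK isClosed_empty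
        (disjoint_empty K)
      exact ⟨φ, ⟨φ.continuous, h2, fun x => (h3 x).1⟩, fun _ x hx => h1 hx⟩
    · exact ⟨0, ⟨continuous_zero, HasCompactSupport.zero, le_rfl⟩, fun h => absurd h hK⟩
  choose φ hφc hφ1 using hφ
  let w : Ω → Ω → ℝ := fun x =>
    if h : ∃ K ∈ S, x ∈ orbitSaturation G K then φ h.choose else 0
  have hw : ∀ K ∈ S, ∀ x ∈ orbitSaturation G K, w x = φ K := by
    intro K hK x hx
    have h : ∃ K ∈ S, x ∈ orbitSaturation G K := ⟨K, hK, hx⟩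
    have hch : h.choose = K :=
      hSd.elim_set h.choose_spec.1 hK x h.choose_spec.2 hx
    simp only [w, dif_pos h, hch]
  refine ⟨w, fun x => ?_, fun g x => ?_, fun L hL => ?_, fun L hL => ?_⟩
  · by_cases h : ∃ K ∈ S, x ∈ orbitSaturation G K
    · simp only [w, dif_pos h]
      exact hφc _
    · simp only [w, dif_neg h]
      exact ⟨continuous_zero, HasCompactSupport.zero, le_rfl⟩
  · simp only [w, smul_mem_orbitSaturation_iff]
  · have h0 : ∀ᵐ x ∂(μ.restrict L), x ∈ L ∧ x ∈ ⋃ K ∈ S, orbitSaturation G K := by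
      filter_upwards [ae_restrict_mem hL.measurableSet,
        ae_restrict_of_ae (s := L) (measure_eq_zero_iff_ae_notMem.1 (hnull L hL))] with x h1 h2
      exact ⟨h1, by_contra fun h => h2 ⟨h1, h⟩⟩
    filter_upwards [h0] with x hx
    obtain ⟨K, hK, hxK⟩ := mem_iUnion₂.1 hx.2
    obtain ⟨g, hg⟩ := hxK
    refine ⟨g, ?_⟩
    rw [hw K hK x ⟨g, hg⟩, hφ1 K (hSK K hK) _ hg]
    exact one_ne_zero
  · refine ⟨orbitSaturation G '' {K ∈ S | (L ∩ orbitSaturation G K).Nonempty},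
      (hcount L hL).image _, measure_mono_null ?_ (hnull L hL), ?_⟩
    · rintro x ⟨hxL, hx⟩
      refine ⟨hxL, fun h => hx ?_⟩
      obtain ⟨K, hK, hxK⟩ := mem_iUnion₂.1 h
      exact ⟨_, ⟨K, ⟨hK, x, hxL, hxK⟩, rfl⟩, hxK⟩
    · rintro _ ⟨K, hK, rfl⟩
      exact ⟨measurableSet_orbitSaturation (hSK K hK.1), φ K, (hφc K).1, (hφc K).2.1,
        hw K hK.1⟩

end Exhaustion

/-! ### Integrals over orbits -/

section SigmaCompact

variable {X : Type u} [TopologicalSpace X] [SigmaCompactSpace X] [MeasurableSpace X]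
  {ν : Measure X}

theorem LocallyAE.ae {p : X → Prop} (h : LocallyAE ν p) : ∀ᵐ x ∂ν, p x := by
  rw [← Measure.restrict_univ (μ := ν), ← iUnion_compactCovering X, ae_restrict_iUnion_iff]
  exact fun n => h _ (isCompact_compactCovering X n)

theorem aemeasurable_of_mem_essBounded {f : X → ℝ} (hf : f ∈ EssBounded ν) :
    AEMeasurable f ν := by
  have h : AEMeasurable f (ν.restrict (⋃ n, compactCovering X n)) :=
    AEMeasurable.iUnion fun n => hf.1 _ (isCompact_compactCovering X n)
  rwa [iUnion_compactCovering, Measure.restrict_univ] at h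

end SigmaCompact

section Orbit

variable {G : Type u} {Ω : Type v} [Group G] [TopologicalSpace G] [TopologicalSpace Ω]
  [MulAction G Ω] {φ : Ω → ℝ}

/-- The compact set of properness contains the support of `g ↦ φ (g⁻¹ x)` for all `x ∈ L`. -/
theorem IsProperAction.apply_inv_smul_eq_zero {L : Set Ω} {x : Ω} (hx : x ∈ L) {g : G}
    (hg : g ∉ closure {g : G | (((fun x : Ω => g • x) '' tsupport φ) ∩ L).Nonempty}) :
    φ (g⁻¹ • x) = 0 := by
  by_contra h
  exact hg (subset_closure ⟨x, ⟨g⁻¹ • x, subset_tsupport _ h, by simp⟩, hx⟩)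

theorem continuous_orbit [ContinuousInv G] [ContinuousSMul G Ω] (hφc : Continuous φ) (x : Ω) :
    Continuous fun g : G => φ (g⁻¹ • x) :=
  hφc.comp (continuous_inv.smul continuous_const)

theorem IsProperAction.hasCompactSupport_orbit (hG : IsProperAction G Ω)
    (hφ : HasCompactSupport φ) (x : Ω) : HasCompactSupport fun g : G => φ (g⁻¹ • x) :=
  HasCompactSupport.intro' (hG _ {x} hφ isCompact_singleton) isClosed_closure
    fun _ hg => IsProperAction.apply_inv_smul_eq_zero (mem_singleton x) hg

end Orbit

section OrbitIntegral

variable {G : Type u} {Ω : Type v} [Group G] [TopologicalSpace G] [IsTopologicalGroup G]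
  [LocallyCompactSpace G] [MeasurableSpace G] [BorelSpace G] [MulAction G Ω]

/-- The integral `∫ f(g) φ(g⁻¹ x) dg` of `φ` along the orbit of `x` with density `f`. -/
noncomputable def orbitIntegral (f : G → ℝ) (φ : Ω → ℝ) (x : Ω) : ℝ :=
  ∫ g, f g * φ (g⁻¹ • x) ∂(Measure.haar : Measure G)

theorem orbitIntegral_translate (f : G → ℝ) (φ : Ω → ℝ) (a : G) (x : Ω) :
    orbitIntegral (fun g => f (a⁻¹ * g)) φ x = orbitIntegral f φ (a⁻¹ • x) := by
  unfold orbitIntegral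
  rw [← integral_mul_left_eq_self _ a]
  simp [mul_smul]

theorem orbitIntegral_nonneg [SigmaCompactSpace G] {φ : Ω → ℝ} (h0 : 0 ≤ φ)
    {f : G → ℝ} (hf : LocallyAE (Measure.haar : Measure G) fun g => 0 ≤ f g) (x : Ω) :
    0 ≤ orbitIntegral f φ x :=
  integral_nonneg_of_ae (hf.ae.mono fun _ hg => mul_nonneg hg (h0 _))

theorem orbitIntegral_eq_zero [SigmaCompactSpace G] {φ : Ω → ℝ} {f : G → ℝ}
    (hf : LocallyAE (Measure.haar : Measure G) fun g => f g = 0) (x : Ω) :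
    orbitIntegral f φ x = 0 :=
  integral_eq_zero_of_ae (hf.ae.mono fun g hg => by simp [hg])

variable [TopologicalSpace Ω] [ContinuousSMul G Ω] {φ : Ω → ℝ}

theorem IsProperAction.integrable_orbit (hG : IsProperAction G Ω) (hφc : Continuous φ)
    (hφ : HasCompactSupport φ) (x : Ω) :
    Integrable (fun g : G => φ (g⁻¹ • x)) (Measure.haar : Measure G) :=
  (continuous_orbit hφc x).integrable_of_hasCompactSupport (hG.hasCompactSupport_orbit hφ x)

theorem IsProperAction.orbitIntegral_one_pos (hG : IsProperAction G Ω) (hφc : Continuous φ)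
    (hφ : HasCompactSupport φ) (h0 : 0 ≤ φ) {x : Ω} (hx : ∃ g : G, φ (g⁻¹ • x) ≠ 0) :
    0 < orbitIntegral (fun _ : G => 1) φ x := by
  obtain ⟨g, hg⟩ := hx
  simpa [orbitIntegral] using
    (continuous_orbit (G := G) hφc x).integral_pos_of_hasCompactSupport_nonneg_nonzero
      (μ := (Measure.haar : Measure G)) (hG.hasCompactSupport_orbit hφ x) (fun g => h0 _) hg

variable [SigmaCompactSpace G]

theorem IsProperAction.integrable_mul_orbit (hG : IsProperAction G Ω) (hφc : Continuous φ)
    (hφ : HasCompactSupport φ) (f : EssBounded (Measure.haar : Measure G)) (x : Ω) :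
    Integrable (fun g : G => f.1 g * φ (g⁻¹ • x)) (Measure.haar : Measure G) := by
  obtain ⟨C, hC⟩ := f.2.2
  exact (hG.integrable_orbit hφc hφ x).bdd_mul (c := C)
    (aemeasurable_of_mem_essBounded f.2).aestronglyMeasurable hC.ae

theorem IsProperAction.orbitIntegral_add (hG : IsProperAction G Ω) (hφc : Continuous φ)
    (hφ : HasCompactSupport φ) (f₁ f₂ : EssBounded (Measure.haar : Measure G)) (x : Ω) :
    orbitIntegral (f₁ + f₂).1 φ x = orbitIntegral f₁.1 φ x + orbitIntegral f₂.1 φ x := by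
  unfold orbitIntegral
  rw [← integral_add (hG.integrable_mul_orbit hφc hφ f₁ x) (hG.integrable_mul_orbit hφc hφ f₂ x)]
  simp [add_mul]

theorem IsProperAction.abs_orbitIntegral_le (hG : IsProperAction G Ω) (hφc : Continuous φ)
    (hφ : HasCompactSupport φ) (h0 : 0 ≤ φ) {f : G → ℝ} {C : ℝ}
    (hC : LocallyAE (Measure.haar : Measure G) fun g => |f g| ≤ C) (x : Ω) :
    |orbitIntegral f φ x| ≤ C * orbitIntegral (fun _ : G => 1) φ x := by
  unfold orbitIntegral
  rw [← integral_const_mul]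
  simp only [one_mul]
  rw [← Real.norm_eq_abs]
  refine norm_integral_le_of_norm_le ((hG.integrable_orbit hφc hφ x).const_mul C)
    (hC.ae.mono fun g hg => ?_)
  rw [norm_mul, Real.norm_eq_abs, Real.norm_of_nonneg (h0 _)]
  exact mul_le_mul_of_nonneg_right hg (h0 _)

/-- Near a given point the integrands are supported in one compact subset of `G`, by properness. -/
theorem IsProperAction.continuous_orbitIntegral [LocallyCompactSpace Ω]
    (hG : IsProperAction G Ω) (hφc : Continuous φ) (hφ : HasCompactSupport φ)
    (f : EssBounded (Measure.haar : Measure G)) : Continuous (orbitIntegral f.1 φ) := by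
  rw [continuous_iff_continuousAt]
  intro x
  obtain ⟨L, hL, hxL⟩ := exists_compact_mem_nhds x
  set k := closure {g : G | (((fun x : Ω => g • x) '' tsupport φ) ∩ L).Nonempty}
  have hk : IsCompact k := hG _ L hφ hL
  have hint : IntegrableOn f.1 k (Measure.haar : Measure G) := by
    obtain ⟨C, hC⟩ := f.2.2
    refine Measure.integrableOn_of_bounded hk.measure_lt_top.ne
      (aemeasurable_of_mem_essBounded f.2).aestronglyMeasurable (M := C) (hC k hk)
  have hcont := continuousOn_integral_bilinear_of_locally_integrable_of_compact_support
    (ContinuousLinearMap.mul ℝ ℝ) (f := fun (x : Ω) (g : G) => φ (g⁻¹ • x)) (s := L) hk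
    (Continuous.continuousOn (by
      refine hφc.comp ?_
      exact (continuous_snd.inv).smul continuous_fst))
    (fun x g hx hg => IsProperAction.apply_inv_smul_eq_zero hx hg) hint
  exact hcont.continuousAt hxL

end OrbitIntegral

/-! ### The averaging operator and invariant means -/

section Averaging

variable {G : Type u} {Ω : Type v} [Group G] [TopologicalSpace G] [IsTopologicalGroup G]
  [LocallyCompactSpace G] [SigmaCompactSpace G] [MeasurableSpace G] [BorelSpace G]
  [TopologicalSpace Ω] [T2Space Ω] [LocallyCompactSpace Ω] [MeasurableSpace Ω] [BorelSpace Ω]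
  [MulAction G Ω] [ContinuousSMul G Ω]

/-- For a proper action there is a positive, unital and equivariant linear map from the essentially
bounded functions on `G` to those on `Ω`, compatible with equality locally almost everywhere. -/
theorem IsProperAction.exists_averaging (hG : IsProperAction G Ω) (μ : Measure Ω)
    [μ.Regular] [SMulInvariantMeasure G Ω μ] :
    ∃ Φ : EssBounded (Measure.haar : Measure G) →ₗ[ℝ] EssBounded μ,
      (∀ f ∈ EssNull (Measure.haar : Measure G), Φ f ∈ EssNull μ) ∧
      (∀ f, LocallyAE (Measure.haar : Measure G) (fun g => 0 ≤ f.1 g) →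
        LocallyAE μ fun x => 0 ≤ (Φ f).1 x) ∧
      (LocallyAE μ fun x => (Φ (EssBounded.one _)).1 x = 1) ∧
      ∀ (a : G) (f), Φ (EssBounded.translate _ a f) = EssBounded.translate μ a (Φ f) := by
  obtain ⟨w, hw, hinv, hne, hloc⟩ := exists_orbit_weight (G := G) μ
  -- Where `w x` vanishes on the orbit of `x`, the quotient below is `0 / 0 = 0`.
  let A : EssBounded (Measure.haar : Measure G) → Ω → ℝ := fun f x =>
    orbitIntegral f.1 (w x) x / orbitIntegral (fun _ : G => 1) (w x) x
  have hone : ∀ x, 0 ≤ orbitIntegral (fun _ : G => 1) (w x) x := fun x =>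
    orbitIntegral_nonneg (hw x).2.2 (fun _ _ => ae_of_all _ fun _ => zero_le_one) x
  have hA : ∀ f, A f ∈ EssBounded μ := by
    intro f
    refine ⟨fun L hL => ?_, ?_⟩
    · obtain ⟨T, hT, hnull, hTA⟩ := hloc L hL
      have : Countable T := hT.to_subtype
      have h1 : AEMeasurable (A f) (μ.restrict (⋃ B : T, (B : Set Ω))) := by
        refine AEMeasurable.iUnion fun B => ?_
        obtain ⟨hB, φ, hφc, hφ, hφw⟩ := hTA B B.2
        have hm : Measurable fun x =>
            orbitIntegral f.1 φ x / orbitIntegral (fun _ : G => 1) φ x :=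
          (hG.continuous_orbitIntegral hφc hφ f).measurable.div
            (hG.continuous_orbitIntegral hφc hφ (EssBounded.one _)).measurable
        refine hm.aemeasurable.congr ?_
        filter_upwards [ae_restrict_mem hB] with x hx
        simp only [A, hφw x hx]
      have h2 : AEMeasurable (A f) (μ.restrict (L \ ⋃₀ T)) := by
        rw [Measure.restrict_eq_zero.2 hnull]
        exact aemeasurable_zero_measure
      refine (aemeasurable_union_iff.2 ⟨h1, h2⟩).mono_measure
        (Measure.restrict_mono ?_ le_rfl)
      rw [← sUnion_eq_iUnion, union_sdiff_self]
      exact subset_union_right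
    · obtain ⟨C, hC⟩ := f.2.2
      refine ⟨C, fun L hL => ?_⟩
      filter_upwards [hne L hL] with x hx
      have hpos := hG.orbitIntegral_one_pos (hw x).1 (hw x).2.1 (hw x).2.2 hx
      rw [abs_div, abs_of_pos hpos, div_le_iff₀ hpos]
      exact hG.abs_orbitIntegral_le (hw x).1 (hw x).2.1 (hw x).2.2 hC x
  refine ⟨{ toFun := fun f => ⟨A f, hA f⟩, map_add' := ?_, map_smul' := ?_ }, ?_, ?_, ?_, ?_⟩
  · intro f₁ f₂
    ext x
    change A (f₁ + f₂) x = A f₁ x + A f₂ x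
    simp only [A]
    rw [hG.orbitIntegral_add (hw x).1 (hw x).2.1, add_div]
  · intro c f
    ext x
    change A (c • f) x = c * A f x
    simp only [A, orbitIntegral]
    rw [mul_div_assoc', ← integral_const_mul]
    simp [mul_assoc]
  · intro f hf L hL
    refine ae_of_all _ fun x => ?_
    change orbitIntegral f.1 (w x) x / _ = 0
    rw [orbitIntegral_eq_zero hf, zero_div]
  · intro f hf L hL
    exact ae_of_all _ fun x => div_nonneg (orbitIntegral_nonneg (hw x).2.2 hf x) (hone x)
  · intro L hL
    filter_upwards [hne L hL] with x hx
    exact div_self (hG.orbitIntegral_one_pos (hw x).1 (hw x).2.1 (hw x).2.2 hx).ne'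
  · intro a f
    ext x
    change A (EssBounded.translate _ a f) x = A f (a⁻¹ • x)
    have h1 := orbitIntegral_translate (Ω := Ω) (fun _ : G => (1 : ℝ)) (w x) a x
    have h2 := orbitIntegral_translate f.1 (w x) a x
    simp only [A, hinv]
    rw [← h1, ← h2]
    rfl

/-- Invariant means are pulled back along the averaging operator. -/
theorem IsProperAction.isAmenable_of_hasInvariantMean (hG : IsProperAction G Ω) (μ : Measure Ω)
    [μ.Regular] [SMulInvariantMeasure G Ω μ] (hμ : HasInvariantMean G μ) : IsAmenable G := by
  obtain ⟨m, hpos, hone, hinv⟩ := hμ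
  obtain ⟨Φ, hnull, hΦpos, hΦone, hΦinv⟩ := hG.exists_averaging μ
  refine ⟨m ∘ₗ (EssNull _).mapQ (EssNull μ) Φ hnull, fun f hf => hpos _ (hΦpos f hf), ?_,
    fun a f => ?_⟩
  · rw [← hone]
    refine congrArg m ((Submodule.Quotient.eq _).2 fun L hL => ?_)
    filter_upwards [hΦone L hL] with x hx
    exact sub_eq_zero.2 hx
  · change m (LInfty.mk (Φ (EssBounded.translate _ a f))) = m (LInfty.mk (Φ f))
    rw [hΦinv, hinv]

end Averaging

/-! ### The action of a group on itself -/

theorem isProperAction_self (G : Type u) [Group G] [TopologicalSpace G] [IsTopologicalGroup G]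
    [T2Space G] : IsProperAction G G := by
  intro K L hK hL
  -- `g K` meets `L` exactly when `g ∈ L K⁻¹`.
  have hc : IsCompact ((fun p : G × G => p.1 * p.2⁻¹) '' (L ×ˢ K)) :=
    (hL.prod hK).image (continuous_fst.mul continuous_snd.inv)
  refine hc.of_isClosed_subset isClosed_closure (closure_minimal ?_ hc.isClosed)
  rintro g ⟨_, ⟨k, hk, rfl⟩, hl⟩
  exact ⟨(g • k, k), ⟨hl, hk⟩, by simp⟩

theorem mainTheorem3 {G : Type u} [Group G] [TopologicalSpace G] [IsTopologicalGroup G]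
    [T2Space G] [LocallyCompactSpace G] [SecondCountableTopology G]
    [MeasurableSpace G] [BorelSpace G] :
    (∀ (Ω : Type v) [TopologicalSpace Ω] [T2Space Ω] [LocallyCompactSpace Ω]
        [MeasurableSpace Ω] [BorelSpace Ω] [MulAction G Ω] [ContinuousSMul G Ω]
        (μ : Measure Ω) [μ.Regular] [SMulInvariantMeasure G Ω μ],
        IsProperAction G Ω → HasInvariantMean G μ → IsAmenable G) ∧
    (IsAmenable G ↔
      ∃ (Ω : Type u) (_ : TopologicalSpace Ω) (_ : T2Space Ω) (_ : LocallyCompactSpace Ω)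
        (_ : MeasurableSpace Ω) (_ : BorelSpace Ω) (_ : MulAction G Ω) (_ : ContinuousSMul G Ω)
        (μ : Measure Ω) (_ : μ.Regular) (_ : SMulInvariantMeasure G Ω μ),
        IsProperAction G Ω ∧ HasInvariantMean G μ) := by
  refine ⟨?_, fun h => ?_, ?_⟩
  · intro Ω _ _ _ _ _ _ _ μ _ _ hG hμ
    exact hG.isAmenable_of_hasInvariantMean μ hμ
  · refine ⟨G, inferInstance, inferInstance, inferInstance, inferInstance, inferInstance,
      inferInstance, inferInstance, Measure.haar, ?_, inferInstance, isProperAction_self G, h⟩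
    unfold Measure.haar
    infer_instance
  · rintro ⟨Ω, _, _, _, _, _, _, _, μ, _, _, hG, hμ⟩
    exact hG.isAmenable_of_hasInvariantMean μ hμ
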